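/- All groups are finite. For a group $G$ let $\mathrm{Irr}(G)=\{\chi_1,\dots,\chi_k\}$ be the set of its complex irreducible characters, numbered so that $\chi_1(1)\le\chi_2(1)\le\dots\le\chi_k(1)$, and put $a_k=\chi_k(1)$, the largest degree of an irreducible character of $G$. A group $G$ is called a $CD1$-group if $|G|>2$ and two columns of the character table of $G$ differ in exactly one entry, i.e. there are $a,b\in G$ such that $\chi(a)\neq\chi(b)$ for exactly one $\chi\in\mathrm{Irr}(G)$. A Frobenius group is a group $G$ with a subgroup $1<H<G$ (a Frobenius complement) such that $H\cap gHg^{-1}=1$ for all $g\in G\setminus H$; its Frobenius kernel $F$ consists of $1$ and the elements of $G$ that lie in no conjugate of $H$. It is called doubly transitive if $|H|=|F|-1$. **Corollary 5.1.** Let $G$ be a finite group and let $r$ be a prime. Then $G$ is a $CD1$-group with $a_k=r$ if and only if one of the following holds: 1. $r=2$ and $G$ is isomorphic to one of the groups $S_3$ (the symmetric group on $3$ letters), $D_8$ (the dihedral group of order $8$) and $Q_8$ (the quaternion group of order $8$); 2. $r=2^n-1$ for some positive integer $n$ (so $r$ is a Mersenne prime), and $G$ is a doubly transitive Frobenius group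 of order $(2^n-1)2^n$. -/

import Mathlib

namespace CD1

/-- The set of (complex) irreducible characters of `G`, as functions `G → ℂ`. Every
finite-dimensional complex representation is isomorphic to one on some `ℂⁿ`, so it is enough to
consider representations on the spaces `Fin n → ℂ`. Irreducible representations are nonzero. -/
def Irr (G : Type*) [Group G] : Set (G → ℂ) :=
  {χ | ∃ (n : ℕ) (ρ : Representation ℂ G (Fin n → ℂ)), ρ.IsIrreducible ∧ χ = ρ.character}

/-- The set of degrees `χ(1)` of the irreducible characters of `G`. -/
def irrDegrees (G : Type*) [Group G] : Set ℕ :=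
  {d | ∃ χ ∈ Irr G, χ 1 = (d : ℂ)}

/-- `G` is a `CD1`-group: `|G| > 2` and two columns of the character table of `G`, those of the
classes of `a` and `b`, differ in exactly one entry, that is `χ(a) ≠ χ(b)` holds for exactly one
irreducible character `χ`. (The classes of such `a` and `b` are automatically distinct.) -/
def IsCD1Group (G : Type*) [Group G] : Prop :=
  2 < Nat.card G ∧ ∃ a b : G, ∃! χ : G → ℂ, χ ∈ Irr G ∧ χ a ≠ χ b

/-- `H` is a Frobenius complement in `G`: `1 < H < G` and `H ∩ Hᵍ = 1` for all `g ∉ H`. -/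
structure IsFrobeniusComplement {G : Type*} [Group G] (H : Subgroup G) : Prop where
  ne_bot : H ≠ ⊥
  ne_top : H ≠ ⊤
  malnormal : ∀ g : G, g ∉ H → ∀ x ∈ H, g * x * g⁻¹ ∈ H → x = 1

/-- The Frobenius kernel belonging to `H`: the identity together with all the elements of `G`
that lie in no conjugate of `H`. -/
def frobeniusKernel {G : Type*} [Group G] (H : Subgroup G) : Set G :=
  {x | x = 1 ∨ ∀ g : G, g * x * g⁻¹ ∉ H}

/-- `G` is a doubly transitive Frobenius group: a Frobenius group whose complement `H` and
kernel `F` satisfy `|H| = |F| - 1`. -/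
def IsDoublyTransitiveFrobenius (G : Type*) [Group G] : Prop :=
  ∃ H : Subgroup G, IsFrobeniusComplement H ∧
    Nat.card H + 1 = Nat.card (frobeniusKernel H)

end CD1

namespace CD1

open Representation Module
open scoped MonoidAlgebra

section Characters

variable {G : Type*} [Group G]

theorem character_mem_Irr {V : Type*} [AddCommGroup V] [Module ℂ V] [FiniteDimensional ℂ V]
    (ρ : Representation ℂ G V) [h : ρ.IsIrreducible] : ρ.character ∈ Irr G := by
  let e : V ≃ₗ[ℂ] (Fin (finrank ℂ V) → ℂ) := (finBasis ℂ V).equivFun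
  let σ : Representation ℂ G (Fin (finrank ℂ V) → ℂ) :=
    { toFun := fun g => e.conj (ρ g)
      map_one' := by simp [LinearEquiv.conj_id, End.one_eq_id]
      map_mul' := fun x y => by simp [End.mul_eq_comp, LinearEquiv.conj_comp] }
  let φ : Representation.Equiv ρ σ := Representation.Equiv.mk e (fun g => by
    ext v; simp [σ, LinearEquiv.conj_apply])
  refine ⟨_, σ, ?_, char_iso φ⟩
  have h1 : IsSimpleModule ℂ[G] ρ.asModule := inferInstance
  rw [irreducible_iff_isSimpleModule_asModule]
  refine IsSimpleModule.congr (N := ρ.asModule)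
    (LinearEquiv.ofBijective (IntertwiningMap.equivLinearMapAsModule _ _ φ.symm.toIntertwiningMap)
      φ.symm.toLinearEquiv.bijective)

theorem Irr.conj_eq {χ : G → ℂ} (hχ : χ ∈ Irr G) {a b : G} (h : IsConj a b) : χ a = χ b := by
  obtain ⟨n, ρ, -, rfl⟩ := hχ
  obtain ⟨c, rfl⟩ := isConj_iff.1 h
  simp

theorem Irr.exists_degree {χ : G → ℂ} (hχ : χ ∈ Irr G) : ∃ d : ℕ, 0 < d ∧ χ 1 = d := by
  obtain ⟨n, ρ, hρ, rfl⟩ := hχ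
  refine ⟨n, ?_, by simp⟩
  rcases Nat.eq_zero_or_pos n with rfl | h
  · exfalso
    have h1 : IsSimpleModule ℂ[G] ρ.asModule := inferInstance
    have := IsSimpleModule.nontrivial ℂ[G] ρ.asModule
    obtain ⟨x, y, hxy⟩ := this
    exact hxy (Subsingleton.elim (α := Fin 0 → ℂ) x y)
  · exact h

theorem Irr.one_ne_zero {χ : G → ℂ} (hχ : χ ∈ Irr G) : χ 1 ≠ 0 := by
  obtain ⟨d, hd, h⟩ := Irr.exists_degree hχ
  rw [h]; exact_mod_cast hd.ne'

variable [Fintype G]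

theorem Irr.sum_mul_inv {χ ψ : G → ℂ} (hχ : χ ∈ Irr G) (hψ : ψ ∈ Irr G) :
    ∑ g, χ g * ψ g⁻¹ = if χ = ψ then (Nat.card G : ℂ) else 0 := by
  have hc : (Nat.card G : ℂ) ≠ 0 := by simp
  let _ : Invertible (Nat.card G : ℂ) := invertibleOfNonzero hc
  have key : ∀ {n m : ℕ} (ρ : Representation ℂ G (Fin n → ℂ)) (σ : Representation ℂ G (Fin m → ℂ))
      (_ : ρ.IsIrreducible) (_ : σ.IsIrreducible), ∑ g, ρ.character g * σ.character g⁻¹ =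
        open scoped Classical in
        (Nat.card G : ℂ) * if Nonempty (Representation.Equiv σ ρ) then 1 else 0 := by
    intro n m ρ σ h1 h2
    rw [← char_orthonormal ρ σ, mul_inv_cancel_left₀ hc]
  split_ifs with h
  · subst h
    obtain ⟨n, ρ, hρ, rfl⟩ := hχ
    rw [key ρ ρ hρ hρ, if_pos ⟨Representation.Equiv.refl ρ⟩, mul_one]
  · obtain ⟨n, ρ, hρ, rfl⟩ := hχ
    obtain ⟨m, σ, hσ, rfl⟩ := hψ
    rw [key ρ σ hρ hσ, if_neg, mul_zero]
    rintro ⟨φ⟩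
    exact h (char_iso φ).symm

theorem sum_smul_inv_eq_zero {V : Type*} [AddCommGroup V] [Module ℂ V] [FiniteDimensional ℂ V]
    (ρ : Representation ℂ G V) [ρ.IsIrreducible] {f : G → ℂ}
    (hf : ∀ a b, IsConj a b → f a = f b) (h0 : ∑ g, f g * ρ.character g⁻¹ = 0) :
    ∑ g, f g • ρ g⁻¹ = 0 := by
  let T : IntertwiningMap ρ ρ :=
    { toLinearMap := ∑ g, f g • ρ g⁻¹
      isIntertwining' := fun h => by
        simp only [← End.mul_eq_comp, Finset.sum_mul, Finset.mul_sum, smul_mul_assoc,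
          mul_smul_comm, ← map_mul]
        refine (Fintype.sum_equiv (MulAut.conj h).toEquiv _ _ fun g => ?_).symm
        have : f (h * (g * h⁻¹)) = f g := by
          rw [← mul_assoc]; exact (hf _ _ (isConj_iff.2 ⟨h, rfl⟩)).symm
        simp [this, mul_assoc] }
  obtain ⟨c, hc⟩ := (IsIrreducible.algebraMap_intertwiningMap_bijective_of_isAlgClosed
    (ρ := ρ)).2 T
  have hT : ∑ g, f g • ρ g⁻¹ = c • (1 : End ℂ V) := by
    have := congrArg IntertwiningMap.toLinearMap hc
    rw [← show T.toLinearMap = ∑ g, f g • ρ g⁻¹ from rfl, ← this]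
    ext v
    rfl
  have htr := congrArg (LinearMap.trace ℂ V) hT
  have h1 : LinearMap.trace ℂ V (∑ g, f g • ρ g⁻¹) = 0 := by
    rw [map_sum, ← h0]; simp [character]
  rw [h1, map_smul, LinearMap.trace_one, smul_eq_mul] at htr
  have hV := Irr.one_ne_zero (character_mem_Irr ρ)
  rw [char_one] at hV
  have : c = 0 := by simpa [hV] using htr.symm
  rw [hT, this, zero_smul]

theorem eq_zero_of_forall_sum_eq_zero {f : G → ℂ} (hf : ∀ a b, IsConj a b → f a = f b)
    (h0 : ∀ χ ∈ Irr G, ∑ g, f g * χ g⁻¹ = 0) : f = 0 := by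
  have : NeZero (Nat.card G : ℂ) := ⟨by simp⟩
  let z : ℂ[G] := ∑ g, MonoidAlgebra.single g⁻¹ (f g)
  have hz : z ∈ Ring.jacobson ℂ[G] := by
    rw [Ring.jacobson, Module.jacobson, Submodule.mem_sInf]
    intro m hm
    have hsimp : IsSimpleModule ℂ[G] (ℂ[G] ⧸ m) := (isSimpleModule_iff_isCoatom).2 hm
    let ρ : Representation ℂ G (ℂ[G] ⧸ m) := Representation.ofModule' (ℂ[G] ⧸ m)
    have hlift : ρ.asAlgebraHom = Algebra.lsmul ℂ ℂ (ℂ[G] ⧸ m) :=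
      (MonoidAlgebra.lift ℂ (Module.End ℂ (ℂ[G] ⧸ m)) G).apply_symm_apply _
    let e : ρ.asModule ≃ₗ[ℂ[G]] (ℂ[G] ⧸ m) :=
      { ρ.asModuleEquiv with
        map_smul' := fun r x => by
          change ρ.asModuleEquiv (r • x) = r • ρ.asModuleEquiv x
          rw [asModuleEquiv_map_smul, hlift]
          rfl }
    have hirr : ρ.IsIrreducible := by
      rw [irreducible_iff_isSimpleModule_asModule]
      exact IsSimpleModule.congr e
    have hρ := sum_smul_inv_eq_zero ρ hf (h0 _ (character_mem_Irr ρ))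
    have hz : ρ.asAlgebraHom z = 0 := by
      rw [← hρ]; simp [z]
    have h1 : z • (Submodule.Quotient.mk (1 : ℂ[G]) : ℂ[G] ⧸ m) = 0 := by
      have := LinearMap.congr_fun hz (Submodule.Quotient.mk (1 : ℂ[G]))
      rwa [hlift] at this
    rwa [← Submodule.Quotient.mk_smul, Submodule.Quotient.mk_eq_zero, smul_eq_mul, mul_one] at h1
  have hz0 : z = 0 := by
    have := IsSemisimpleRing.jacobson_eq_bot (R := ℂ[G])
    rw [this] at hz
    simpa using hz
  classical
  funext a
  have h1 : z.coeff a⁻¹ = 0 := by rw [hz0]; rfl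
  simpa [z, Finsupp.single_apply] using h1

theorem apply_eq_one_of_trace_eq {V : Type*} [AddCommGroup V] [Module ℂ V]
    [FiniteDimensional ℂ V] {A : End ℂ V} {m : ℕ} (hm : m ≠ 0) (hA : A ^ m = 1)
    (htr : LinearMap.trace ℂ V A = finrank ℂ V) : A = 1 := by
  have hroot : ∀ x ∈ A.charpoly.roots, x ^ m = 1 := by
    intro x hx
    have hx' : A.HasEigenvalue x :=
      (End.hasEigenvalue_iff_isRoot_charpoly A x).2 (Polynomial.isRoot_of_mem_roots hx)
    obtain ⟨v, hv⟩ := hx'.exists_hasEigenvector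
    have h1 := hv.pow_apply m
    rw [hA, End.one_apply] at h1
    by_contra hne
    refine hv.2 ?_
    have : (x ^ m - 1) • v = 0 := by rw [sub_smul, ← h1, one_smul, sub_self]
    exact (smul_eq_zero.1 this).resolve_left (sub_ne_zero.2 hne)
  have hsp : A.charpoly.Splits := IsAlgClosed.splits _
  have hcard : A.charpoly.roots.card = finrank ℂ V := by
    rw [← LinearMap.charpoly_natDegree A, hsp.natDegree_eq_card_roots]
  have hsum := End.trace_eq_sum_roots_charpoly_of_splits hsp
  rw [htr, ← hcard] at hsum
  have hone : ∀ x ∈ A.charpoly.roots, x = 1 := by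
    have hnorm : ∀ x ∈ A.charpoly.roots, ‖x‖ = 1 := fun x hx =>
      Complex.norm_eq_one_of_pow_eq_one (hroot x hx) hm
    have hre : (A.charpoly.roots.map fun x => 1 - x.re).sum = 0 := by
      have h1 := congrArg Complex.reAddGroupHom hsum
      rw [map_multiset_sum] at h1
      simp only [Complex.coe_reAddGroupHom, Complex.natCast_re] at h1
      rw [Multiset.sum_map_sub, ← h1]
      simp
    intro x hx
    have h2 : 1 - x.re = 0 := Multiset.all_zero_of_le_zero_le_of_sum_eq_zero (by
      intro y hy
      obtain ⟨w, hw, rfl⟩ := Multiset.mem_map.1 hy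
      have := (Complex.re_le_norm w).trans_eq (hnorm w hw)
      linarith) hre _ (Multiset.mem_map_of_mem (fun x : ℂ => 1 - x.re) hx)
    have h3 : x.re = ‖x‖ := by rw [hnorm x hx]; linarith
    have h4 : x.im = 0 := Complex.abs_re_eq_norm.1 (by rw [h3, abs_norm])
    exact Complex.ext (by rw [h3, hnorm x hx, Complex.one_re]) (by rw [h4, Complex.one_im])
  have hpoly : A.charpoly = (Polynomial.X - Polynomial.C 1) ^ finrank ℂ V := by
    rw [hsp.eq_prod_roots_of_monic A.charpoly_monic, ← hcard,
      Multiset.eq_replicate_card.2 hone]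
    simp
  have hnil : IsNilpotent (A - 1) := by
    refine ⟨finrank ℂ V, ?_⟩
    have := A.aeval_self_charpoly
    rw [hpoly] at this
    simpa using this
  have hss : A.IsSemisimple := by
    refine End.isSemisimple_of_squarefree_aeval_eq_zero (p := Polynomial.X ^ m - Polynomial.C 1) ?_
      (by simp [hA])
    exact (Polynomial.separable_X_pow_sub_C 1 (by exact_mod_cast hm) one_ne_zero).squarefree
  have hss' : (A - 1).IsSemisimple := by
    have := (End.isSemisimple_sub_algebraMap_iff (f := A) (μ := (1 : ℂ))).2 hss
    simpa using this
  exact sub_eq_zero.1 (End.eq_zero_of_isNilpotent_isSemisimple hnil hss')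

theorem Irr.apply_eq_one {n : ℕ} (ρ : Representation ℂ G (Fin n → ℂ)) {c : G}
    (h : ρ.character c = ρ.character 1) : ρ c = 1 := by
  refine apply_eq_one_of_trace_eq (m := Nat.card G) Nat.card_pos.ne' ?_ ?_
  · rw [← map_pow, pow_card_eq_one', map_one]
  · rw [← char_one ρ, ← h]; rfl

theorem Irr.linearIndependent : LinearIndependent ℂ (Subtype.val : Irr G → G → ℂ) := by
  rw [linearIndependent_iff']
  intro s c hc ψ hψ
  have h1 : ∑ g, (∑ χ ∈ s, c χ • χ.1) g * ψ.1 g⁻¹ = 0 := by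
    rw [hc]; simp
  simp only [Finset.sum_apply, Pi.smul_apply, smul_eq_mul, Finset.sum_mul] at h1
  rw [Finset.sum_comm] at h1
  simp only [mul_assoc, ← Finset.mul_sum, Irr.sum_mul_inv (Subtype.mem _) (Subtype.mem _)] at h1
  have h2 : (Nat.card G : ℂ) ≠ 0 := by simp
  rw [Finset.sum_eq_single ψ] at h1
  · simpa [h2] using h1
  · intro χ _ hne
    rw [if_neg (fun h => hne (Subtype.ext h)), mul_zero]
  · exact fun h => absurd hψ h

instance : Finite (Irr G) := Irr.linearIndependent.finite

noncomputable instance : Fintype (Irr G) := Fintype.ofFinite _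

open scoped Classical in
theorem Irr.sum_inv_mul (a c : G) : ∑ χ : Irr G, χ.1 a⁻¹ * χ.1 c =
    if IsConj a c then (Nat.card G : ℂ) / Nat.card {x // IsConj a x} else 0 := by
  have hG : (Nat.card G : ℂ) ≠ 0 := by simp
  have hne : Nonempty {x // IsConj a x} := ⟨⟨a, IsConj.refl a⟩⟩
  have hk : (Nat.card {x // IsConj a x} : ℂ) ≠ 0 := by
    exact_mod_cast (Nat.card_pos (α := {x // IsConj a x})).ne'
  set k : ℂ := (Nat.card {x // IsConj a x} : ℂ) with hkdef
  let F : G → ℂ := fun x => (if IsConj a x then 1 else 0) -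
    ∑ χ : Irr G, k * χ.1 a⁻¹ / Nat.card G * χ.1 x
  have hF : F = 0 := by
    apply eq_zero_of_forall_sum_eq_zero
    · intro x y hxy
      have : IsConj a x ↔ IsConj a y := ⟨fun h => h.trans hxy, fun h => h.trans hxy.symm⟩
      simp only [F, this]
      congr 1
      exact Finset.sum_congr rfl fun χ _ => by rw [Irr.conj_eq χ.2 hxy]
    · intro ψ hψ
      simp only [F, sub_mul, Finset.sum_sub_distrib, Finset.sum_mul]
      rw [Finset.sum_comm]
      simp only [mul_assoc, ← Finset.mul_sum, Irr.sum_mul_inv (Subtype.mem _) hψ]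
      rw [Finset.sum_eq_single (⟨ψ, hψ⟩ : Irr G) (fun χ _ h => by
        rw [if_neg fun h' => h (Subtype.ext h'), mul_zero]) (by simp)]
      have h1 : ∀ g, (if IsConj a g then (1 : ℂ) else 0) * ψ g⁻¹ =
          if IsConj a g then ψ a⁻¹ else 0 := by
        intro g
        split_ifs with h
        · rw [one_mul]
          refine (Irr.conj_eq hψ ?_).symm
          obtain ⟨c, rfl⟩ := isConj_iff.1 h
          exact isConj_iff.2 ⟨c, by group⟩
        · rw [zero_mul]
      rw [Finset.sum_congr rfl fun g _ => h1 g, ← Finset.sum_filter, Finset.sum_const,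
        nsmul_eq_mul, ← Fintype.card_subtype, ← Nat.card_eq_fintype_card, ← hkdef, if_pos rfl]
      field_simp
      ring
  have h2 := congrFun hF c
  simp only [F, Pi.zero_apply, sub_eq_zero] at h2
  have h3 : ∑ χ : Irr G, k * χ.1 a⁻¹ / Nat.card G * χ.1 c =
      k / Nat.card G * ∑ χ : Irr G, χ.1 a⁻¹ * χ.1 c := by
    rw [Finset.mul_sum]
    exact Finset.sum_congr rfl fun χ _ => by ring
  rw [h3] at h2
  split_ifs at h2 ⊢ with h
  · field_simp at h2 ⊢
    rw [← h2]
  · have h4 : k / Nat.card G ≠ 0 := div_ne_zero hk hG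
    exact (mul_eq_zero.1 h2.symm).resolve_left h4

theorem Irr.isConj_of_forall_eq {a b : G} (h : ∀ χ ∈ Irr G, χ a = χ b) : IsConj a b := by
  classical
  have h1 := Irr.sum_inv_mul a a
  have h2 := Irr.sum_inv_mul a b
  by_contra hab
  rw [Finset.sum_congr rfl fun χ _ => by rw [← h χ.1 χ.2], h1, if_pos (IsConj.refl a),
    if_neg hab] at h2
  have hne : Nonempty {x // IsConj a x} := ⟨⟨a, IsConj.refl a⟩⟩
  have : Nat.card G = 0 ∨ Nat.card {x // IsConj a x} = 0 := by
    simpa only [div_eq_zero_iff, Nat.cast_eq_zero] using h2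
  rcases this with h | h
  · exact Nat.card_pos.ne' h
  · exact Nat.card_pos.ne' h

theorem Irr.sum_degree_mul (c : G) [Decidable (c = 1)] :
    ∑ χ : Irr G, χ.1 1 * χ.1 c = if c = 1 then (Nat.card G : ℂ) else 0 := by
  have := Irr.sum_inv_mul 1 c
  simp only [inv_one, isConj_one_right] at this
  rw [this]
  split_ifs with h1
  · simp
  · rfl

end Characters

/-- A nontrivial normal subgroup `N` whose nonidentity elements form a single conjugacy class of
`G`, such that every element outside `N` is conjugate to all elements of its coset of `N`. -/
structure IsCaminaSubgroup {G : Type*} [Group G] (N : Subgroup G) : Prop where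
  normal : N.Normal
  ne_bot : N ≠ ⊥
  isConj : ∀ x ∈ N, ∀ y ∈ N, x ≠ 1 → y ≠ 1 → IsConj x y
  isConj_mul : ∀ g, g ∉ N → ∀ n ∈ N, IsConj g (g * n)

section Camina

variable {G : Type*} [Group G]

theorem sum_normal_eq_zero {N : Subgroup G} [Fintype N] (hN : N.Normal)
    {V : Type*} [AddCommGroup V] [Module ℂ V] (ρ : Representation ℂ G V) [hρ : ρ.IsIrreducible]
    {n₀ : G} (hn₀ : n₀ ∈ N) (h : ρ n₀ ≠ 1) : ∑ n : N, ρ n = 0 := by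
  set S : End ℂ V := ∑ n : N, ρ n with hS
  have hfix : ρ n₀ * S = S := by
    rw [hS, Finset.mul_sum]
    exact Fintype.sum_equiv (Equiv.mulLeft (⟨n₀, hn₀⟩ : N)) _ _ fun n => by simp
  have hcomm : ∀ g, ρ g * S = S * ρ g := by
    intro g
    rw [hS, Finset.mul_sum, Finset.sum_mul]
    refine Fintype.sum_equiv (MulAut.conjNormal g : MulAut N).toEquiv _ _ fun n => ?_
    simp [← map_mul]
  let W : Subrepresentation ρ :=
    { toSubmodule := LinearMap.range S
      apply_mem_toSubmodule := by
        rintro g _ ⟨v, rfl⟩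
        exact ⟨ρ g v, (LinearMap.congr_fun (hcomm g) v).symm⟩ }
  rcases eq_bot_or_eq_top W with hW | hW
  · have : LinearMap.range S = ⊥ := congrArg Subrepresentation.toSubmodule hW
    exact LinearMap.range_eq_bot.1 this
  · have : LinearMap.range S = ⊤ := congrArg Subrepresentation.toSubmodule hW
    exfalso
    apply h
    ext v
    obtain ⟨w, rfl⟩ := LinearMap.range_eq_top.1 this v
    exact LinearMap.congr_fun hfix w

theorem IsCaminaSubgroup.one_lt_card [Finite G] {N : Subgroup G} (hN : IsCaminaSubgroup N) :
    1 < Nat.card N := by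
  rw [Subgroup.one_lt_card_iff_ne_bot]; exact hN.ne_bot

variable {N : Subgroup G} (hN : IsCaminaSubgroup N) {χ : G → ℂ} (hχ : χ ∈ Irr G)
  {n₀ : G} (hn₀ : n₀ ∈ N) (hne : χ n₀ ≠ χ 1)

include hN hχ hn₀ hne

theorem IsCaminaSubgroup.sum_mul_eq_zero [Fintype N] (g : G) : ∑ n : N, χ (g * n) = 0 := by
  obtain ⟨m, ρ, hρ, rfl⟩ := hχ
  have h := sum_normal_eq_zero hN.normal ρ hn₀ (fun h => hne (by simp [character, h]))
  have h1 : LinearMap.trace ℂ _ (ρ g * ∑ n : N, ρ n) = 0 := by rw [h, mul_zero, map_zero]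
  rw [Finset.mul_sum, map_sum] at h1
  simp only [← map_mul] at h1
  exact h1

variable [Finite G]

theorem IsCaminaSubgroup.apply_eq_zero {g : G} (hg : g ∉ N) : χ g = 0 := by
  have := Fintype.ofFinite N
  have h := hN.sum_mul_eq_zero hχ hn₀ hne g
  rw [Finset.sum_congr rfl fun (n : N) _ =>
    (Irr.conj_eq hχ (hN.isConj_mul g hg n n.2)).symm] at h
  simpa using h

theorem IsCaminaSubgroup.card_sub_one_mul {n : G} (hn : n ∈ N) (hn1 : n ≠ 1) :
    ((Nat.card N : ℂ) - 1) * χ n = - χ 1 := by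
  classical
  have := Fintype.ofFinite N
  have h := hN.sum_mul_eq_zero hχ hn₀ hne 1
  rw [← Finset.add_sum_erase _ _ (Finset.mem_univ (1 : N))] at h
  rw [Finset.sum_congr rfl (g := fun _ => χ n)] at h
  · rw [Finset.sum_const, Finset.card_erase_of_mem (Finset.mem_univ _), Finset.card_univ,
      nsmul_eq_mul, Nat.cast_sub Fintype.card_pos, ← Nat.card_eq_fintype_card] at h
    simp only [OneMemClass.coe_one, mul_one, Nat.cast_one] at h
    linear_combination h
  · intro x hx
    rw [one_mul]
    refine Irr.conj_eq hχ (hN.isConj _ x.2 _ hn ?_ hn1)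
    simpa using hx

theorem IsCaminaSubgroup.sum_eq [Fintype G] {ψ : G → ℂ} (hψ : ψ ∈ Irr G) {n₁ : G}
    (hn₁ : n₁ ∈ N) (hne₁ : ψ n₁ ≠ ψ 1) :
    ((Nat.card N : ℂ) - 1) * ∑ g, χ g * ψ g⁻¹ = Nat.card N * (χ 1 * ψ 1) := by
  classical
  have := Fintype.ofFinite N
  have hq : (Nat.card N : ℂ) - 1 ≠ 0 := by
    have := hN.one_lt_card
    rw [sub_ne_zero]
    exact_mod_cast this.ne'
  have h1 : ∑ g, χ g * ψ g⁻¹ = ∑ n : N, χ n * ψ (n : G)⁻¹ := by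
    rw [← Finset.sum_subtype (Finset.univ.filter (· ∈ N)) (by simp) fun g => χ g * ψ g⁻¹]
    refine (Finset.sum_subset (Finset.filter_subset _ _) fun g _ hg => ?_).symm
    rw [hN.apply_eq_zero hχ hn₀ hne (by simpa using hg), zero_mul]
  rw [h1, ← Finset.add_sum_erase _ _ (Finset.mem_univ (1 : N))]
  rw [Finset.sum_congr rfl (g := fun _ => χ 1 * ψ 1 / ((Nat.card N : ℂ) - 1) ^ 2)]
  · rw [Finset.sum_const, Finset.card_erase_of_mem (Finset.mem_univ _), Finset.card_univ,
      nsmul_eq_mul, Nat.cast_sub Fintype.card_pos, ← Nat.card_eq_fintype_card]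
    simp only [OneMemClass.coe_one, inv_one, Nat.cast_one]
    field_simp
    ring
  · intro x hx
    have hx1 : (x : G) ≠ 1 := by simpa using hx
    have e1 := hN.card_sub_one_mul hχ hn₀ hne x.2 hx1
    have e2 := hN.card_sub_one_mul hψ hn₁ hne₁ (N.inv_mem x.2) (by simpa using hx1)
    rw [eq_div_iff (pow_ne_zero _ hq)]
    linear_combination ((Nat.card N : ℂ) - 1) * ψ (x : G)⁻¹ * e1 - χ 1 * e2

theorem IsCaminaSubgroup.degree_sq_mul_card {d : ℕ} (hd : χ 1 = d) :
    d ^ 2 * Nat.card N + Nat.card G = Nat.card G * Nat.card N := by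
  have := Fintype.ofFinite G
  have h := hN.sum_eq hχ hn₀ hne hχ hn₀ hne
  rw [Irr.sum_mul_inv hχ hχ, if_pos rfl, hd] at h
  have : (d : ℂ) ^ 2 * Nat.card N + Nat.card G = Nat.card G * Nat.card N := by
    linear_combination -h
  exact_mod_cast this

theorem IsCaminaSubgroup.isGreatest_degree {d : ℕ} (hd : χ 1 = d) :
    IsGreatest (irrDegrees G) d := by
  classical
  have := Fintype.ofFinite G
  refine ⟨⟨χ, hχ, hd⟩, ?_⟩
  rintro e ⟨ψ, hψ, he⟩
  by_cases hψχ : ψ = χ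
  · subst hψχ
    have : e = d := by exact_mod_cast he.symm.trans hd
    exact this.le
  have hdeg : ∀ φ : Irr G, ∃ d : ℕ, φ.1 1 = d := fun φ =>
    (Irr.exists_degree φ.2).imp fun _ h => h.2
  choose deg hdeg using hdeg
  have hsum : ∑ φ, deg φ ^ 2 = Nat.card G := by
    have h := Irr.sum_degree_mul (1 : G)
    simp only [hdeg, ↓reduceIte, ← sq] at h
    exact_mod_cast h
  have hle : deg ⟨ψ, hψ⟩ ^ 2 + deg ⟨χ, hχ⟩ ^ 2 ≤ Nat.card G := by
    rw [← hsum, ← Finset.sum_pair (f := fun φ => deg φ ^ 2)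
      (fun h => hψχ (congrArg Subtype.val h))]
    exact Finset.sum_le_sum_of_subset (Finset.subset_univ _)
  have h1 : deg ⟨ψ, hψ⟩ = e := by exact_mod_cast (hdeg ⟨ψ, hψ⟩).symm.trans he
  have h2 : deg ⟨χ, hχ⟩ = d := by exact_mod_cast (hdeg ⟨χ, hχ⟩).symm.trans hd
  rw [h1, h2] at hle
  have h3 := hN.degree_sq_mul_card hχ hn₀ hne hd
  have h4 := hN.one_lt_card
  by_contra hlt
  push Not at hlt
  nlinarith

end Camina

section CD1Group

variable {G : Type*} [Group G] [Finite G]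

theorem IsCaminaSubgroup.isCD1Group {N : Subgroup G} (hN : IsCaminaSubgroup N)
    (hG : 2 < Nat.card G) {r : ℕ} (hr : r ^ 2 * Nat.card N + Nat.card G = Nat.card G * Nat.card N) :
    IsCD1Group G ∧ IsGreatest (irrDegrees G) r := by
  have := Fintype.ofFinite G
  obtain ⟨⟨n, hn⟩, hn'⟩ := Subgroup.ne_bot_iff_exists_ne_one.1 hN.ne_bot
  have hn1 : n ≠ 1 := fun h => hn' (Subtype.ext h)
  obtain ⟨χ, hχ, hne⟩ : ∃ χ ∈ Irr G, χ n ≠ χ 1 := by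
    by_contra! h
    exact hn1 (isConj_one_left.1 (Irr.isConj_of_forall_eq h))
  obtain ⟨d, -, hd⟩ := Irr.exists_degree hχ
  refine ⟨⟨hG, n, 1, χ, ⟨hχ, hne⟩, ?_⟩, ?_⟩
  · rintro ψ ⟨hψ, hneψ⟩
    by_contra h
    have h1 := hN.sum_eq hψ hn hneψ hχ hn hne
    rw [Irr.sum_mul_inv hψ hχ, if_neg h, mul_zero] at h1
    have h2 : (Nat.card N : ℂ) ≠ 0 := by exact_mod_cast Nat.card_pos.ne'
    exact mul_ne_zero h2 (mul_ne_zero (Irr.one_ne_zero hψ) (Irr.one_ne_zero hχ)) h1.symm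
  · have h1 := hN.degree_sq_mul_card hχ hn hne hd
    have h2 : r ^ 2 * Nat.card N = d ^ 2 * Nat.card N := by omega
    have h3 : r = d := Nat.pow_left_injective two_ne_zero
      (Nat.eq_of_mul_eq_mul_right Nat.card_pos h2)
    rw [h3]
    exact hN.isGreatest_degree hχ hn hne hd

theorem IsCD1Group.exists_unique_ne (h : IsCD1Group G) : ∃ b : G, b ≠ 1 ∧ ∃ χ ∈ Irr G,
    χ b ≠ χ 1 ∧ ∀ ψ ∈ Irr G, ψ ≠ χ → ψ b = ψ 1 := by
  classical
  have := Fintype.ofFinite G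
  obtain ⟨-, a, b, χ, ⟨hχ, hab⟩, huniq⟩ := h
  have hsum : ∑ ψ : Irr G, (ψ.1 1 * ψ.1 a - ψ.1 1 * ψ.1 b) = χ 1 * (χ a - χ b) := by
    rw [Finset.sum_eq_single (⟨χ, hχ⟩ : Irr G)]
    · ring
    · intro ψ _ hne
      have : ψ.1 a = ψ.1 b := by
        by_contra h
        exact hne (Subtype.ext (huniq ψ.1 ⟨ψ.2, h⟩))
      rw [this, sub_self]
    · simp
  rw [Finset.sum_sub_distrib, Irr.sum_degree_mul, Irr.sum_degree_mul] at hsum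
  have hne0 : χ 1 * (χ a - χ b) ≠ 0 := mul_ne_zero (Irr.one_ne_zero hχ) (sub_ne_zero.2 hab)
  by_cases ha : a = 1
  · subst ha
    refine ⟨b, ?_, χ, hχ, hab.symm, fun ψ hψ h => ?_⟩
    · rintro rfl; exact hab rfl
    · by_contra h'
      exact h (huniq ψ ⟨hψ, Ne.symm h'⟩)
  · by_cases hb : b = 1
    · subst hb
      refine ⟨a, ha, χ, hχ, hab, fun ψ hψ h => ?_⟩
      by_contra h'
      exact h (huniq ψ ⟨hψ, h'⟩)
    · rw [if_neg ha, if_neg hb, sub_zero] at hsum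
      exact absurd hsum.symm hne0

theorem IsCD1Group.exists_isCaminaSubgroup (h : IsCD1Group G) : ∃ N : Subgroup G,
    IsCaminaSubgroup N ∧ ∃ n ∈ N, ∃ χ ∈ Irr G, χ n ≠ χ 1 := by
  classical
  have := Fintype.ofFinite G
  obtain ⟨b, hb1, χ, hχ, hbχ, hψ⟩ := h.exists_unique_ne
  have hvan : ∀ g, g ≠ 1 → ¬ IsConj g b → χ g⁻¹ = 0 := by
    intro g hg hgb
    have hsum : ∑ ψ : Irr G, (ψ.1 g⁻¹ * ψ.1 b - ψ.1 g⁻¹ * ψ.1 1) = χ g⁻¹ * (χ b - χ 1) := by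
      rw [Finset.sum_eq_single (⟨χ, hχ⟩ : Irr G)]
      · ring
      · intro ψ _ hne
        rw [hψ ψ.1 ψ.2 fun h => hne (Subtype.ext h), sub_self]
      · simp
    rw [Finset.sum_sub_distrib, Irr.sum_inv_mul, Irr.sum_inv_mul, if_neg hgb,
      if_neg (by rwa [isConj_one_left]), sub_zero] at hsum
    exact (mul_eq_zero.1 hsum.symm).resolve_right (sub_ne_zero.2 hbχ)
  let N : Subgroup G :=
    { carrier := {c | ∀ (n : ℕ) (ρ : Representation ℂ G (Fin n → ℂ)), ρ.IsIrreducible →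
        ρ.character ≠ χ → ρ c = 1}
      one_mem' := fun n ρ _ _ => map_one ρ
      mul_mem' := fun {x y} hx hy n ρ h1 h2 => by
        rw [map_mul, hx n ρ h1 h2, hy n ρ h1 h2, one_mul]
      inv_mem' := fun {x} hx n ρ h1 h2 => by
        have := map_mul ρ x⁻¹ x
        rwa [inv_mul_cancel, map_one, hx n ρ h1 h2, mul_one, eq_comm] at this }
  have hNχ : ∀ c ∈ N, ∀ ψ ∈ Irr G, ψ ≠ χ → ∀ g, ψ (g * c) = ψ g := by
    rintro c hc _ ⟨n, ρ, hρ, rfl⟩ hne g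
    rw [character, map_mul, hc n ρ hρ hne, mul_one]; rfl
  have hmem : ∀ c, (∀ ψ ∈ Irr G, ψ ≠ χ → ψ c = ψ 1) → c ∈ N := fun c hc n ρ hρ hne =>
    Irr.apply_eq_one ρ (hc _ ⟨n, ρ, hρ, rfl⟩ hne)
  have hNb : b ∈ N := hmem b hψ
  have hconj : ∀ c ∈ N, c ≠ 1 → IsConj c b := by
    intro c hc hc1
    refine Irr.isConj_of_forall_eq fun ψ hψ' => ?_
    have hval : ∀ x ∈ N, x ≠ 1 → χ 1 * (χ 1 - χ x) = Nat.card G := by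
      intro x hx hx1
      have hsum : ∑ ψ : Irr G, (ψ.1 1 * ψ.1 1 - ψ.1 1 * ψ.1 x) = χ 1 * (χ 1 - χ x) := by
        rw [Finset.sum_eq_single (⟨χ, hχ⟩ : Irr G)]
        · ring
        · intro ψ _ hne
          have := hNχ x hx ψ.1 ψ.2 (fun h => hne (Subtype.ext h)) 1
          rw [one_mul] at this
          rw [this, sub_self]
        · simp
      rw [← hsum, Finset.sum_sub_distrib, Irr.sum_degree_mul, Irr.sum_degree_mul, if_pos rfl,
        if_neg hx1, sub_zero]
    by_cases hψχ : ψ = χ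
    · subst hψχ
      have := mul_left_cancel₀ (Irr.one_ne_zero hχ) ((hval c hc hc1).trans (hval b hNb hb1).symm)
      linear_combination -this
    · have h1 := hNχ c hc ψ hψ' hψχ 1
      rw [one_mul] at h1
      rw [h1, hψ ψ hψ' hψχ]
  have hvan' : ∀ g, g ∉ N → χ g = 0 := by
    intro g hg
    rw [← inv_inv g]
    refine hvan _ (fun h => hg ?_) (fun h => hg ?_)
    · rw [inv_eq_one.1 h]; exact N.one_mem
    · refine N.inv_mem_iff.1 (hmem _ fun ψ hψ' hne => ?_)
      rw [Irr.conj_eq hψ' h, hψ ψ hψ' hne]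
  refine ⟨N, ⟨⟨fun c hc g => hmem _ fun ψ hψ' hne => ?_⟩, ?_, ?_, ?_⟩, b, hNb, χ, hχ, hbχ⟩
  · rw [← Irr.conj_eq hψ' (isConj_iff.2 ⟨g, rfl⟩ : IsConj c _), ← hNχ c hc ψ hψ' hne 1, one_mul]
  · intro h
    rw [h] at hNb
    exact hb1 (Subgroup.mem_bot.1 hNb)
  · exact fun x hx y hy hx1 hy1 => (hconj x hx hx1).trans (hconj y hy hy1).symm
  · intro g hg n hn
    refine Irr.isConj_of_forall_eq fun ψ hψ' => ?_
    by_cases hψχ : ψ = χ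
    · subst hψχ
      rw [hvan' g hg, hvan' _ fun h => hg ((N.mul_mem_cancel_right hn).1 h)]
    · exact (hNχ n hn ψ hψ' hψχ g).symm

theorem isCD1Group_and_isGreatest_iff {r : ℕ} : IsCD1Group G ∧ IsGreatest (irrDegrees G) r ↔
    2 < Nat.card G ∧ ∃ N : Subgroup G, IsCaminaSubgroup N ∧
      r ^ 2 * Nat.card N + Nat.card G = Nat.card G * Nat.card N := by
  constructor
  · rintro ⟨h, hr⟩
    obtain ⟨N, hN, n, hn, χ, hχ, hne⟩ := h.exists_isCaminaSubgroup
    obtain ⟨d, -, hd⟩ := Irr.exists_degree hχ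
    rw [hr.unique (hN.isGreatest_degree hχ hn hne hd)]
    exact ⟨h.1, N, hN, hN.degree_sq_mul_card hχ hn hne hd⟩
  · rintro ⟨hG, N, hN, hr⟩
    exact hN.isCD1Group hG hr

end CD1Group

section Groups

variable {G : Type*} [Group G]

theorem card_centralizer_mul_card_isConj [Finite G] (x : G) :
    Nat.card (Subgroup.centralizer {x}) * Nat.card {y // IsConj x y} = Nat.card G := by
  have h1 : Nat.card {y // IsConj x y} = (MulAction.orbit (ConjAct G) x).ncard := by
    rw [← Nat.card_coe_set_eq]
    refine Nat.card_congr (Equiv.subtypeEquivRight fun y => ?_)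
    rw [ConjAct.mem_orbit_conjAct, isConj_comm]
  rw [h1, Subgroup.nat_card_centralizer_nat_card_stabilizer, ← MulAction.index_stabilizer,
    Subgroup.card_mul_index]
  rfl

theorem IsCaminaSubgroup.comap {K : Type*} [Group K] (e : G ≃* K) {N : Subgroup K}
    (hN : IsCaminaSubgroup N) : IsCaminaSubgroup (N.comap e.toMonoidHom) := by
  have hc : ∀ {x y : G}, IsConj (e x) (e y) → IsConj x y := by
    intro x y h
    have := e.symm.toMonoidHom.map_isConj h
    simpa using this
  refine ⟨hN.normal.comap _, ?_, ?_, ?_⟩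
  · intro h
    refine hN.ne_bot ((Subgroup.eq_bot_iff_forall _).2 fun x hx => ?_)
    have h1 : e.symm x ∈ N.comap e.toMonoidHom := by simpa using hx
    rw [h, Subgroup.mem_bot] at h1
    simpa using h1
  · intro x hx y hy hx1 hy1
    exact hc (hN.isConj _ hx _ hy (by simpa using hx1) (by simpa using hy1))
  · intro g hg n hn
    refine hc ?_
    rw [map_mul]
    exact hN.isConj_mul _ hg _ hn

theorem isCD1Group_of_mulEquiv {K : Type*} [Group K] [Finite G] (e : G ≃* K)
    {N : Subgroup K} (hN : IsCaminaSubgroup N) {r : ℕ} (hK : 2 < Nat.card K)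
    (hr : r ^ 2 * Nat.card N + Nat.card K = Nat.card K * Nat.card N) :
    IsCD1Group G ∧ IsGreatest (irrDegrees G) r := by
  have h1 : Nat.card G = Nat.card K := Nat.card_congr e.toEquiv
  have h2 : Nat.card (N.comap e.toMonoidHom) = Nat.card N :=
    Nat.card_congr (e.toEquiv.subtypeEquiv fun _ => Iff.rfl)
  exact (hN.comap e).isCD1Group (by omega) (by rw [h1, h2, hr])

theorem mem_zpowers_of_sq_eq_one {x y : G} (hx : x ^ 2 = 1) :
    y ∈ Subgroup.zpowers x ↔ y = 1 ∨ y = x := by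
  constructor
  · rintro ⟨k, rfl⟩
    rcases Int.even_or_odd' k with ⟨m, rfl | rfl⟩
    · left
      simp only [zpow_mul]
      norm_cast
      rw [hx, one_zpow]
    · right
      simp only [zpow_add, zpow_mul, zpow_one]
      norm_cast
      rw [hx, one_zpow, one_mul]
  · rintro (rfl | rfl)
    · exact Subgroup.one_mem _
    · exact Subgroup.mem_zpowers _

theorem isCaminaSubgroup_alternatingGroup :
    IsCaminaSubgroup (alternatingGroup (Fin 3)) := by
  refine ⟨inferInstance, ?_, ?_, ?_⟩
  · rw [← Subgroup.one_lt_card_iff_ne_bot, Nat.card_eq_fintype_card]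
    decide
  · simp only [isConj_iff, Equiv.Perm.mem_alternatingGroup]; decide
  · simp only [isConj_iff, Equiv.Perm.mem_alternatingGroup]; decide

theorem isCaminaSubgroup_dihedralGroup :
    IsCaminaSubgroup (Subgroup.zpowers (DihedralGroup.r 2 : DihedralGroup 4)) := by
  have hmem : ∀ x : DihedralGroup 4, x ∈ Subgroup.zpowers (DihedralGroup.r 2 : DihedralGroup 4) ↔
      x = 1 ∨ x = DihedralGroup.r 2 := fun _ => mem_zpowers_of_sq_eq_one (by decide)
  refine ⟨⟨?_⟩, ?_, ?_, ?_⟩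
  · simp only [hmem]; decide
  · rw [Subgroup.zpowers_ne_bot]; decide
  · simp only [hmem, isConj_iff]; decide
  · simp only [hmem, isConj_iff]; decide

theorem isCaminaSubgroup_quaternionGroup :
    IsCaminaSubgroup (Subgroup.zpowers (QuaternionGroup.a 2 : QuaternionGroup 2)) := by
  have hmem : ∀ x : QuaternionGroup 2,
      x ∈ Subgroup.zpowers (QuaternionGroup.a 2 : QuaternionGroup 2) ↔
      x = 1 ∨ x = QuaternionGroup.a 2 := fun _ => mem_zpowers_of_sq_eq_one (by decide)
  refine ⟨⟨?_⟩, ?_, ?_, ?_⟩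
  · simp only [hmem]; decide
  · rw [Subgroup.zpowers_ne_bot]; decide
  · simp only [hmem, isConj_iff]; decide
  · simp only [hmem, isConj_iff]; decide

theorem equiv_dihedral_or_quaternion (hG : Nat.card G = 8) (hcomm : ∃ a b : G, a * b ≠ b * a) :
    Nonempty (G ≃* DihedralGroup 4) ∨ Nonempty (G ≃* QuaternionGroup 2) := by
  have hfin : Finite G := Nat.finite_of_card_ne_zero (by omega)
  obtain ⟨a, b, hab⟩ := hcomm
  obtain ⟨x, hx⟩ : ∃ x : G, x ^ 2 ≠ 1 := by
    by_contra! h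
    have hinv : ∀ z : G, z⁻¹ = z := fun z => by
      rw [inv_eq_iff_mul_eq_one, ← sq, h]
    apply hab
    rw [← hinv (a * b), mul_inv_rev, hinv, hinv]
  have hx4 : orderOf x = 4 := by
    have h1 : orderOf x ∣ 2 ^ 3 := by
      have := orderOf_dvd_natCard x
      rwa [hG] at this
    obtain ⟨k, hk, h2⟩ := (Nat.dvd_prime_pow Nat.prime_two).1 h1
    have h3 : ¬ orderOf x ∣ 2 := fun h => hx (orderOf_dvd_iff_pow_eq_one.1 h)
    interval_cases k
    · simp [h2] at h3
    · simp [h2] at h3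
    · exact h2
    · exfalso
      have hcyc : IsCyclic G := isCyclic_of_orderOf_eq_card x (by rw [h2, hG]; rfl)
      exact hab (IsMulCommutative.is_comm.comm a b)
  set H := Subgroup.zpowers x with hH
  have hHcard : Nat.card H = 4 := by rw [hH, Nat.card_zpowers, hx4]
  have hHi : H.index = 2 := by
    have := H.card_mul_index
    rw [hHcard, hG] at this; omega
  have hHn : H.Normal := Subgroup.normal_of_index_eq_two hHi
  obtain ⟨y, hy⟩ : ∃ y, y ∉ H := by
    by_contra! h
    have : H = ⊤ := (Subgroup.eq_top_iff' H).2 h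
    rw [this, Subgroup.index_top] at hHi
    omega
  let p : ZMod 4 → G := fun i => x ^ i.val
  have hpow : ∀ k : ℕ, x ^ k = p k := by
    intro k
    simp only [p, ZMod.val_natCast]
    rw [← hx4, pow_mod_orderOf]
  have hp0 : p 0 = 1 := by simp [p]
  have hpadd : ∀ i j, p (i + j) = p i * p j := by
    intro i j
    have := hpow (i.val + j.val)
    rw [pow_add] at this
    rw [this]
    simp
  have hpinj : Function.Injective p := by
    intro i j h
    apply ZMod.val_injective
    refine pow_injOn_Iio_orderOf ?_ ?_ h
    · rw [hx4]; exact ZMod.val_lt i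
    · rw [hx4]; exact ZMod.val_lt j
  have hpH : ∀ i, p i ∈ H := fun i => Subgroup.pow_mem _ (Subgroup.mem_zpowers x) _
  have hHp : ∀ z ∈ H, ∃ i, z = p i := by
    intro z hz
    obtain ⟨k, hk⟩ := mem_powers_iff_mem_zpowers.2 hz
    exact ⟨k, by rw [← hpow, ← hk]⟩
  have hcases : ∀ z, z ∈ H ∨ ∃ i, z = y * p i := by
    intro z
    by_cases hz : z ∈ H
    · exact Or.inl hz
    · right
      have : y⁻¹ * z ∈ H := by
        rw [Subgroup.mul_mem_iff_of_index_two hHi]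
        simp [hy, hz]
      obtain ⟨i, hi⟩ := hHp _ this
      exact ⟨i, by rw [← hi]; group⟩
  have hp1 : p 1 = x := by rw [← Nat.cast_one, ← hpow, pow_one]
  have hyx : y * x ≠ x * y := by
    intro h
    have hcy : ∀ i, Commute y (p i) := fun i => (Commute.pow_right h _ : Commute y (x ^ i.val))
    have hcp : ∀ i j, Commute (p i) (p j) := fun i j => by
      rw [Commute, SemiconjBy, ← hpadd, ← hpadd, add_comm]
    have hcy' : ∀ z, Commute y z := by
      intro z
      rcases hcases z with hz | ⟨i, rfl⟩
      · obtain ⟨i, rfl⟩ := hHp z hz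
        exact hcy i
      · exact (Commute.refl y).mul_right (hcy i)
    have hcp' : ∀ i z, Commute (p i) z := by
      intro i z
      rcases hcases z with hz | ⟨j, rfl⟩
      · obtain ⟨j, rfl⟩ := hHp z hz
        exact hcp i j
      · exact (hcy i).symm.mul_right (hcp i j)
    apply hab
    rcases hcases a with ha | ⟨i, rfl⟩
    · obtain ⟨i, rfl⟩ := hHp a ha
      exact hcp' i b
    · exact (hcy' b).mul_left (hcp' i b)
  obtain ⟨k, hk⟩ : ∃ k, y * x * y⁻¹ = p k := hHp _ (hHn.conj_mem _ (Subgroup.mem_zpowers x) y)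
  have hconjpow : ∀ i, y * p i * y⁻¹ = p (k * i) := by
    intro i
    have h1 : p (k * i) = p k ^ i.val := by
      have : ∀ m : ℕ, p k ^ m = p (k * m) := by
        intro m
        induction m with
        | zero => simp [hp0]
        | succ m ih => rw [pow_succ, ih, ← hpadd]; congr 1; push_cast; ring
      rw [this]; simp
    rw [h1, ← hk, conj_pow]
  have hk3 : k = -1 := by
    have h1 : k ≠ 1 := by
      rintro rfl
      rw [hp1, mul_inv_eq_iff_eq_mul] at hk
      exact hyx hk
    have h2 : 2 * k ≠ 0 := by
      intro h
      have h3 := hconjpow 2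
      rw [mul_comm, h, hp0, mul_inv_eq_one, mul_eq_left, ← hp0] at h3
      exact absurd (hpinj h3) (by decide)
    clear hk hconjpow
    revert h1 h2 k; decide
  subst hk3
  have hpy : ∀ i, p i * y = y * p (-i) := by
    intro i
    have := hconjpow (-i)
    rw [neg_mul_neg, one_mul, mul_inv_eq_iff_eq_mul] at this
    exact this.symm
  obtain ⟨m, hm⟩ : ∃ m, y * y = p m := hHp _ (Subgroup.mul_self_mem_of_index_two hHi y)
  have hm2 : m = 0 ∨ m = 2 := by
    have h1 := hpy m
    rw [← hm, mul_assoc, mul_left_cancel_iff, hm] at h1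
    have h2 := hpinj h1
    clear hm h1
    revert m; decide
  have hyp : ∀ i j, y * p i ≠ p j := by
    intro i j h
    apply hy
    rw [eq_mul_inv_of_mul_eq h]
    exact H.mul_mem (hpH j) (H.inv_mem (hpH i))
  have hpyp : ∀ i j, p i * (y * p j) = y * p (j - i) := by
    intro i j
    rw [← mul_assoc, hpy, mul_assoc, ← hpadd, neg_add_eq_sub]
  have hypyp : ∀ i j, y * p i * (y * p j) = p (m + j - i) := by
    intro i j
    rw [mul_assoc, hpyp, ← mul_assoc, hm, ← hpadd, add_sub_assoc]
  rcases hm2 with rfl | rfl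
  · left
    let f : DihedralGroup 4 →* G := MonoidHom.mk'
      (fun d => match d with
        | .r i => p i
        | .sr i => y * p i) (by
      rintro (i | i) (j | j)
      · exact hpadd i j
      · exact (hpyp i j).symm
      · exact (congrArg _ (hpadd i j)).trans (mul_assoc _ _ _).symm
      · rw [hypyp, zero_add]; rfl)
    have hf : Function.Injective f := by
      rintro (i | i) (j | j) h
      · exact congrArg _ (hpinj h)
      · exact absurd h.symm (hyp _ _)
      · exact absurd h (hyp _ _)
      · exact congrArg _ (hpinj (mul_left_cancel h))
    exact ⟨(MulEquiv.ofBijective f ((Nat.bijective_iff_injective_and_card f).2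
      ⟨hf, by rw [hG, DihedralGroup.nat_card]⟩)).symm⟩
  · right
    let f : QuaternionGroup 2 →* G := MonoidHom.mk'
      (fun d => match d with
        | .a i => p i
        | .xa i => y * p i) (by
      rintro (i | i) (j | j)
      · exact hpadd i j
      · exact (hpyp i j).symm
      · exact (congrArg _ (hpadd i j)).trans (mul_assoc _ _ _).symm
      · exact (hypyp i j).symm)
    have hf : Function.Injective f := by
      rintro (i | i) (j | j) h
      · exact congrArg _ (hpinj h)
      · exact absurd h.symm (hyp _ _)
      · exact absurd h (hyp _ _)
      · exact congrArg _ (hpinj (mul_left_cancel h))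
    exact ⟨(MulEquiv.ofBijective f ((Nat.bijective_iff_injective_and_card f).2
      ⟨hf, by rw [hG, Nat.card_eq_fintype_card, QuaternionGroup.card]⟩)).symm⟩

end Groups

section Degree

variable {G : Type*} [Group G] [Finite G] {N : Subgroup G}

theorem IsCaminaSubgroup.card_isConj (hN : IsCaminaSubgroup N) {x : G} (hx : x ∈ N)
    (hx1 : x ≠ 1) : Nat.card {y // IsConj x y} + 1 = Nat.card N := by
  have h : {y | IsConj x y} = (N : Set G) \ {1} := by
    ext y
    simp only [Set.mem_ofPred_eq, Set.mem_sdiff, SetLike.mem_coe, Set.mem_singleton_iff]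
    constructor
    · intro h
      obtain ⟨c, rfl⟩ := isConj_iff.1 h
      exact ⟨hN.normal.conj_mem _ hx c, by simpa using hx1⟩
    · rintro ⟨hy, hy1⟩
      exact hN.isConj x hx y hy hx1 hy1
  have h1 : Nat.card {y // IsConj x y} = ((N : Set G) \ {1}).ncard := by
    rw [← h]; rfl
  rw [h1, Set.ncard_sdiff_singleton_add_one (SetLike.mem_coe.2 N.one_mem) (Set.toFinite _)]
  rfl

theorem IsCaminaSubgroup.index_ne_one (hN : IsCaminaSubgroup N) (hG : 2 < Nat.card G) :
    N.index ≠ 1 := by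
  intro h
  obtain ⟨⟨x, hx⟩, hx'⟩ := Subgroup.ne_bot_iff_exists_ne_one.1 hN.ne_bot
  have h1 := hN.card_isConj hx (fun h => hx' (Subtype.ext h))
  have h2 := card_centralizer_mul_card_isConj x
  have h3 := N.card_mul_index
  rw [h, mul_one] at h3
  have h4 : Nat.card {y // IsConj x y} ∣ 1 := by
    rw [← Nat.dvd_add_right (dvd_refl _), h1, h3]
    exact ⟨_, by rw [← h2, mul_comm]⟩
  have := Nat.dvd_one.1 h4
  omega

theorem IsCaminaSubgroup.index_eq_of_prime (hN : IsCaminaSubgroup N) (hG : 2 < Nat.card G) {r : ℕ}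
    (hr : r.Prime) (h : r ^ 2 * Nat.card N + Nat.card G = Nat.card G * Nat.card N) :
    (Nat.card N = 2 ∧ N.index = r ^ 2) ∨ (Nat.card N = r + 1 ∧ N.index = r) := by
  have h1 := hN.one_lt_card
  obtain ⟨m, hm⟩ : ∃ m, Nat.card N = m + 1 := ⟨Nat.card N - 1, by omega⟩
  have h3 := N.card_mul_index
  rw [← h3, hm] at h
  have h4 : r ^ 2 = N.index * m := by
    apply Nat.eq_of_mul_eq_mul_left (show 0 < m + 1 by omega)
    nlinarith
  obtain ⟨k, hk, h5⟩ := (Nat.dvd_prime_pow hr).1 (show m ∣ r ^ 2 from ⟨_, by rw [h4, mul_comm]⟩)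
  have hr0 := hr.pos
  interval_cases k
  · left
    constructor
    · rw [hm, h5]; rfl
    · rw [h4, h5]; simp
  · right
    rw [pow_one] at h5
    refine ⟨by rw [hm, h5], ?_⟩
    rw [h5, sq] at h4
    exact (Nat.eq_of_mul_eq_mul_right hr0 h4).symm
  · exfalso
    rw [h5] at h4
    apply hN.index_ne_one hG
    exact Nat.eq_of_mul_eq_mul_right (pow_pos hr0 2) (by rw [← h4, one_mul])

theorem IsCaminaSubgroup.eq_two_of_card_eq_two (hN : IsCaminaSubgroup N) {r : ℕ}
    (hr : r.Prime) (h2 : Nat.card N = 2) (hi : N.index = r ^ 2) :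
    r = 2 ∧ (Nonempty (G ≃* DihedralGroup 4) ∨ Nonempty (G ≃* QuaternionGroup 2)) := by
  obtain ⟨⟨z, hz⟩, hz'⟩ := Subgroup.ne_bot_iff_exists_ne_one.1 hN.ne_bot
  have hz1 : z ≠ 1 := fun h => hz' (Subtype.ext h)
  have hcard := N.card_mul_index
  rw [h2, hi] at hcard
  have hc : ∀ g : G, g * z = z * g := by
    intro g
    have h3 := hN.card_isConj hz hz1
    have h4 : Nat.card {y // IsConj z y} = 1 := by omega
    obtain ⟨h5, -⟩ := Nat.card_eq_one_iff_unique.1 h4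
    have h6 := congrArg Subtype.val (h5.elim ⟨z, IsConj.refl z⟩ ⟨g * z * g⁻¹, isConj_iff.2 ⟨g, rfl⟩⟩)
    exact (eq_mul_inv_iff_mul_eq.1 h6).symm
  have hr2 : r = 2 := by
    by_contra hne
    have := Fact.mk hr
    obtain ⟨g, hg⟩ := exists_prime_orderOf_dvd_card' (G := G) r
      ⟨2 * r, by rw [← hcard]; ring⟩
    have hgN : g ∉ N := by
      intro h
      have h3 := N.orderOf_dvd_natCard h
      rw [hg, h2] at h3
      exact hne ((Nat.prime_dvd_prime_iff_eq hr Nat.prime_two).1 h3)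
    obtain ⟨c, hc'⟩ := isConj_iff.1 (hN.isConj_mul g hgN z hz)
    have h4 : (g * z) ^ r = 1 := by
      rw [← hc', conj_pow, ← hg, pow_orderOf_eq_one]; simp
    rw [(show Commute g z from hc g).mul_pow, ← hg, pow_orderOf_eq_one, one_mul, hg] at h4
    have h5 := orderOf_dvd_of_pow_eq_one h4
    have h6 := N.orderOf_dvd_natCard hz
    rw [h2] at h6
    rcases (Nat.dvd_prime Nat.prime_two).1 h6 with h7 | h7
    · exact hz1 (orderOf_eq_one_iff.1 h7)
    · rw [h7] at h5
      exact hne ((Nat.prime_dvd_prime_iff_eq Nat.prime_two hr).1 h5).symm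
  refine ⟨hr2, equiv_dihedral_or_quaternion (by rw [← hcard, hr2]; rfl) ?_⟩
  by_contra! hcomm
  have hne : N ≠ ⊤ := by
    rintro rfl
    rw [Subgroup.index_top, hr2] at hi
    omega
  obtain ⟨g, hg⟩ : ∃ g, g ∉ N := by
    by_contra! h
    exact hne ((Subgroup.eq_top_iff' N).2 h)
  obtain ⟨c, hc'⟩ := isConj_iff.1 (hN.isConj_mul g hg z hz)
  rw [hcomm c g, mul_inv_cancel_right] at hc'
  exact hz1 (by simpa using hc')

theorem IsCaminaSubgroup.equiv_perm (hN : IsCaminaSubgroup N)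
    (h3 : Nat.card N = 3) (hi : N.index = 2) : Nonempty (G ≃* Equiv.Perm (Fin 3)) := by
  have hcard := N.card_mul_index
  rw [h3, hi] at hcard
  have := Fact.mk Nat.prime_two
  obtain ⟨x, hx⟩ := exists_prime_orderOf_dvd_card' (G := G) 2 ⟨3, by rw [← hcard]⟩
  have hx1 : x ≠ 1 := by
    rintro rfl
    rw [orderOf_one] at hx
    omega
  have hxN : x ∉ N := by
    intro h
    have h4 := N.orderOf_dvd_natCard h
    rw [hx, h3] at h4
    omega
  set H := Subgroup.zpowers x with hH
  have hHmem : ∀ y, y ∈ H ↔ y = 1 ∨ y = x := fun y =>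
    mem_zpowers_of_sq_eq_one (by rw [← hx, pow_orderOf_eq_one])
  have hHc : Nat.card H = 2 := by rw [hH, Nat.card_zpowers, hx]
  have hHi : Nat.card (G ⧸ H) = 3 := by
    have h4 := H.card_mul_index
    rw [hHc, ← hcard] at h4
    rw [← Subgroup.index_eq_card]; omega
  have hcore : H.normalCore = ⊥ := by
    rw [Subgroup.eq_bot_iff_forall]
    intro y hy
    rcases (hHmem y).1 (Subgroup.normalCore_le H hy) with rfl | rfl
    · rfl
    exfalso
    obtain ⟨⟨n, hn⟩, hn'⟩ := Subgroup.ne_bot_iff_exists_ne_one.1 hN.ne_bot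
    have hn1 : n ≠ 1 := fun h => hn' (Subtype.ext h)
    obtain ⟨c, hc⟩ := isConj_iff.1 (hN.isConj_mul y hxN n hn)
    have h5 := Subgroup.normalCore_le H ((Subgroup.normalCore_normal H).conj_mem y hy c)
    rw [hc, hHmem] at h5
    rcases h5 with h5 | h5
    · rw [← inv_eq_iff_mul_eq_one] at h5
      exact hxN (N.inv_mem_iff.1 (h5 ▸ hn))
    · exact hn1 (by simpa using h5)
  have hinj : Function.Injective (MulAction.toPermHom G (G ⧸ H)) := by
    rw [← MonoidHom.ker_eq_bot_iff, ← Subgroup.normalCore_eq_ker, hcore]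
  let e : (G ⧸ H) ≃ Fin 3 := Finite.equivFinOfCardEq hHi
  exact ⟨(MulEquiv.ofBijective _ ((Nat.bijective_iff_injective_and_card _).2
    ⟨hinj, by rw [Nat.card_perm, hHi, ← hcard]; rfl⟩)).trans e.permCongrHom⟩

theorem IsCaminaSubgroup.isDoublyTransitiveFrobenius (hN : IsCaminaSubgroup N) {r : ℕ}
    (hr : r.Prime) (hc : Nat.card N = r + 1) (hi : N.index = r) :
    IsDoublyTransitiveFrobenius G := by
  have := Fact.mk hr
  have := hN.normal
  have hcard := N.card_mul_index
  rw [hc, hi] at hcard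
  obtain ⟨h, hh⟩ := exists_prime_orderOf_dvd_card' (G := G) r ⟨r + 1, by rw [← hcard, mul_comm]⟩
  set H := Subgroup.zpowers h with hH
  have hHc : Nat.card H = r := by rw [hH, Nat.card_zpowers, hh]
  have hHN : ∀ x ∈ H, x ∈ N → x = 1 := by
    intro x hxH hxN
    have h1 := H.orderOf_dvd_natCard hxH
    have h2 := N.orderOf_dvd_natCard hxN
    rw [hHc] at h1
    rw [hc, Nat.dvd_add_right h1] at h2
    exact orderOf_eq_one_iff.1 (Nat.dvd_one.1 h2)
  have hh1 : h ≠ 1 := by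
    rintro rfl
    rw [orderOf_one] at hh
    exact hr.one_lt.ne hh
  have hQ : Nat.card (G ⧸ N) = r := by rw [← Subgroup.index_eq_card, hi]
  have hconj : ∀ g, g ∉ N → ∃ x ∈ H, IsConj x g := by
    intro g hg
    have hne : (h : G ⧸ N) ≠ 1 := fun h' =>
      hh1 (hHN h (Subgroup.mem_zpowers h) ((QuotientGroup.eq_one_iff h).1 h'))
    obtain ⟨k, hk⟩ := mem_zpowers_of_prime_card hQ hne (g' := (g : G ⧸ N))
    have hk' : (h ^ k)⁻¹ * g ∈ N := by
      rw [← QuotientGroup.eq, ← hk]; rfl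
    refine ⟨h ^ k, Subgroup.zpow_mem_zpowers h k, ?_⟩
    have h1 : h ^ k ∉ N := by
      intro h2
      have := N.mul_mem h2 hk'
      rw [mul_inv_cancel_left] at this
      exact hg this
    have := hN.isConj_mul _ h1 _ hk'
    rwa [mul_inv_cancel_left] at this
  have hker : frobeniusKernel H = (N : Set G) := by
    ext x
    constructor
    · rintro (rfl | hx)
      · exact N.one_mem
      · by_contra hxN
        obtain ⟨y, hy, hyx⟩ := hconj x hxN
        obtain ⟨c, rfl⟩ := isConj_iff.1 hyx.symm
        exact hx c hy
    · intro hx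
      by_cases hx1 : x = 1
      · exact Or.inl hx1
      · refine Or.inr fun g hg => hx1 ?_
        have := hHN _ hg (hN.normal.conj_mem x hx g)
        simpa using this
  refine ⟨H, ⟨?_, ?_, ?_⟩, ?_⟩
  · rw [← Subgroup.one_lt_card_iff_ne_bot, hHc]
    exact hr.one_lt
  · intro hT
    rw [hT, Subgroup.card_top] at hHc
    nlinarith [hr.pos]
  · intro g hg x hx hgx
    by_contra hx1
    have hxN : x ∉ N := fun h => hx1 (hHN x hx h)
    have hcycQ : IsCyclic (G ⧸ N) := isCyclic_of_prime_card hQ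
    have h1 : g * x * g⁻¹ * x⁻¹ = 1 := by
      refine hHN _ (H.mul_mem hgx (H.inv_mem hx)) ?_
      rw [← QuotientGroup.eq_one_iff]
      have : (g : G ⧸ N) * x = x * g := IsMulCommutative.is_comm.comm _ _
      rw [QuotientGroup.mk_mul, QuotientGroup.mk_mul, QuotientGroup.mk_mul, this,
        QuotientGroup.mk_inv, QuotientGroup.mk_inv]
      group
    have hgc : g ∈ Subgroup.centralizer {x} := by
      rw [Subgroup.mem_centralizer_singleton_iff]
      rw [mul_inv_eq_one, mul_inv_eq_iff_eq_mul] at h1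
      exact h1
    have hle : H ≤ Subgroup.centralizer {x} := by
      intro y hy
      rw [Subgroup.mem_centralizer_singleton_iff]
      obtain ⟨i, rfl⟩ := hx
      obtain ⟨j, rfl⟩ := hy
      exact (Commute.refl h).zpow_zpow j i
    have hcl : r + 1 ≤ Nat.card {y // IsConj x y} := by
      rw [← hc]
      refine Nat.card_le_card_of_injective
        (fun n : N => (⟨x * n, hN.isConj_mul x hxN n n.2⟩ : {y // IsConj x y})) ?_
      intro n m hnm
      exact Subtype.ext (mul_left_cancel (congrArg Subtype.val hnm))
    have hcc := card_centralizer_mul_card_isConj x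
    rw [← hcard] at hcc
    have heq : H = Subgroup.centralizer {x} := by
      refine Subgroup.eq_of_le_of_card_ge hle ?_
      rw [hHc]
      by_contra! hlt
      nlinarith
    rw [heq] at hg
    exact hg hgc
  · rw [hHc, hker, ← hc]
    rfl

theorem IsCaminaSubgroup.exists_card_eq_two_pow (hN : IsCaminaSubgroup N)
    (h2 : 2 ∣ Nat.card N) : ∃ n, Nat.card N = 2 ^ n := by
  have := Fact.mk Nat.prime_two
  rw [← IsPGroup.iff_card]
  obtain ⟨t, ht⟩ := exists_prime_orderOf_dvd_card' (G := N) 2 h2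
  have ht1 : (t : G) ≠ 1 := by
    intro h
    have : t = 1 := Subtype.ext h
    rw [this, orderOf_one] at ht
    omega
  intro x
  refine ⟨1, ?_⟩
  by_cases hx : (x : G) = 1
  · rw [show x = 1 from Subtype.ext hx, one_pow]
  · obtain ⟨c, hc⟩ := isConj_iff.1 (hN.isConj t t.2 x x.2 ht1 hx)
    have h3 : (t : G) ^ 2 = 1 := by
      have := pow_orderOf_eq_one t
      rw [ht] at this
      exact_mod_cast congrArg Subtype.val this
    apply Subtype.ext
    push_cast
    rw [← hc, conj_pow, h3]
    simp

end Degree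

section Frobenius

variable {G : Type*} [Group G] [Finite G]

theorem IsFrobeniusComplement.card_frobeniusKernel {H : Subgroup G}
    (hH : IsFrobeniusComplement H) : Nat.card (frobeniusKernel H) * Nat.card H = Nat.card G := by
  have hH1 : 0 < Nat.card H := Nat.card_pos
  let f : (G ⧸ H) × {x : H // x ≠ 1} → ↥(frobeniusKernel H)ᶜ := fun p =>
    ⟨p.1.out * (p.2.1 : G) * p.1.out⁻¹, by
      rintro (h | h)
      · exact p.2.2 (by simpa using h)
      · refine h p.1.out⁻¹ ?_
        convert p.2.1.2 using 1
        group⟩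
  have hf : Function.Bijective f := by
    constructor
    · rintro ⟨a, ⟨x, hx⟩⟩ ⟨b, ⟨y, hy⟩⟩ h
      have h1 : a.out * (x : G) * a.out⁻¹ = b.out * (y : G) * b.out⁻¹ := congrArg Subtype.val h
      have h2 : (b.out⁻¹ * a.out) * (x : G) * (b.out⁻¹ * a.out)⁻¹ = y := by
        have : (b.out⁻¹ * a.out) * (x : G) * (b.out⁻¹ * a.out)⁻¹ =
          b.out⁻¹ * (a.out * (x : G) * a.out⁻¹) * b.out := by group
        rw [this, h1]; group
      have h3 : b.out⁻¹ * a.out ∈ H := by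
        by_contra h4
        refine hx (Subtype.ext (hH.malnormal _ h4 x x.2 ?_))
        rw [h2]; exact y.2
      have h4 : b = a := by
        rw [← Quotient.out_eq' a, ← Quotient.out_eq' b]
        exact Quotient.sound' (QuotientGroup.leftRel_apply.2 h3)
      subst h4
      have : x = y := by
        apply Subtype.ext
        simpa using h2
      subst this
      rfl
    · rintro ⟨x, hx⟩
      have hx1 : x ≠ 1 := fun h => hx (Or.inl h)
      obtain ⟨g, hg⟩ : ∃ g, g * x * g⁻¹ ∈ H := by
        by_contra! h
        exact hx (Or.inr h)
      let a : G ⧸ H := ((g⁻¹ : G) : G ⧸ H)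
      have h1 : g * a.out ∈ H := by
        have : (a.out : G ⧸ H) = ((g⁻¹ : G) : G ⧸ H) := Quotient.out_eq' a
        have := QuotientGroup.eq.1 this.symm
        simpa using this
      have h2 : a.out⁻¹ * x * a.out ∈ H := by
        have := H.mul_mem (H.mul_mem (H.inv_mem h1) hg) h1
        convert this using 1
        group
      refine ⟨(a, ⟨⟨_, h2⟩, ?_⟩), ?_⟩
      · intro h
        have := congrArg Subtype.val h
        apply hx1
        simpa [mul_assoc, inv_mul_eq_one] using this
      · apply Subtype.ext
        simp [f]; group
  have h1 := Nat.card_congr (Equiv.ofBijective f hf)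
  have h2 : Nat.card {x : H // x ≠ 1} + 1 = Nat.card H := by
    have : Nat.card {x : H // x ≠ 1} = ((Set.univ : Set H) \ {1}).ncard := by
      rw [← Nat.card_coe_set_eq]
      exact Nat.card_congr (Equiv.subtypeEquivRight (by simp))
    rw [this, Set.ncard_sdiff_singleton_add_one (Set.mem_univ _) (Set.toFinite _), Set.ncard_univ]
  have h3 : Nat.card (frobeniusKernel H) + Nat.card ↥(frobeniusKernel H)ᶜ = Nat.card G := by
    rw [Nat.card_coe_set_eq, Nat.card_coe_set_eq, Set.ncard_add_ncard_compl]
  rw [← h1, Nat.card_prod, ← Subgroup.index_eq_card] at h3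
  have h4 := H.card_mul_index
  have h5 : Nat.card (frobeniusKernel H) = H.index := by
    rw [← h4, ← h2] at h3
    nlinarith
  rw [h5, mul_comm, h4]

theorem IsFrobeniusComplement.isCaminaSubgroup {H : Subgroup G} (hH : IsFrobeniusComplement H)
    {N : Subgroup G} (hN : frobeniusKernel H = N) (hc : Nat.card H + 1 = Nat.card N) :
    IsCaminaSubgroup N := by
  have hmem : ∀ x, x ∈ N ↔ x = 1 ∨ ∀ g : G, g * x * g⁻¹ ∉ H := fun x => by
    rw [← SetLike.mem_coe, ← hN]; rfl
  have hfix : ∀ x ∈ H, x ≠ 1 → ∀ g, g * x * g⁻¹ = x → g ∈ H := by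
    intro x hx hx1 g hg
    by_contra h
    exact hx1 (hH.malnormal g h x hx (by rwa [hg]))
  have hNH : ∀ x ∈ N, ∀ g, g * x * g⁻¹ ∈ H → x = 1 := fun x hx g hg =>
    ((hmem x).1 hx).resolve_right fun h => h g hg
  have hnormal : N.Normal := by
    refine ⟨fun n hn g => (hmem _).2 ?_⟩
    rcases (hmem n).1 hn with rfl | h
    · left; simp
    · right
      intro k hk
      apply h (k * g)
      convert hk using 1
      group
  refine ⟨hnormal, ?_, ?_, ?_⟩
  · rw [← Subgroup.one_lt_card_iff_ne_bot, ← hc]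
    have : 0 < Nat.card H := Nat.card_pos
    omega
  · intro x hx y hy hx1 hy1
    let f : H → {z : N // z ≠ 1} := fun h =>
      ⟨⟨h * x * (h : G)⁻¹, hnormal.conj_mem x hx h⟩, fun h' => hx1 (by
        simpa using congrArg Subtype.val h')⟩
    have hf : Function.Injective f := by
      intro a b hab
      have h1 : (a : G) * x * (a : G)⁻¹ = b * x * (b : G)⁻¹ :=
        congrArg (fun z : {z : N // z ≠ 1} => ((z : N) : G)) hab
      by_contra hne
      have h2 : ((b⁻¹ * a : H) : G) ≠ 1 := by
        intro h
        apply hne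
        have : b⁻¹ * a = 1 := Subtype.ext h
        exact (inv_mul_eq_one.1 this).symm
      have h3 : x ∈ H := by
        refine hfix _ (b⁻¹ * a : H).2 h2 x ?_
        push_cast
        have h4 : (b : G)⁻¹ * a * x = x * ((b : G)⁻¹ * a) := by
          have : (b : G)⁻¹ * a * x = (b : G)⁻¹ * (a * x * (a : G)⁻¹) * a := by group
          rw [this, h1]; group
        rw [← h4, mul_inv_cancel_right]
      exact hx1 (hNH x hx 1 (by simpa using h3))
    have hcard : Nat.card H = Nat.card {z : N // z ≠ 1} := by
      have : Nat.card {z : N // z ≠ 1} = ((Set.univ : Set N) \ {1}).ncard := by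
        rw [← Nat.card_coe_set_eq]
        exact Nat.card_congr (Equiv.subtypeEquivRight (by simp))
      have h2 := Set.ncard_sdiff_singleton_add_one (Set.mem_univ (1 : N)) (Set.toFinite _)
      rw [Set.ncard_univ] at h2
      omega
    obtain ⟨h, hh⟩ := ((Nat.bijective_iff_injective_and_card f).2 ⟨hf, hcard⟩).2
      ⟨⟨y, hy⟩, fun h => hy1 (congrArg Subtype.val h)⟩
    exact isConj_iff.2 ⟨h, congrArg (fun z : {z : N // z ≠ 1} => ((z : N) : G)) hh⟩
  · intro g hg n hn
    have hg1 : g ≠ 1 := by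
      rintro rfl
      exact hg N.one_mem
    obtain ⟨k, hk⟩ : ∃ k, k * g * k⁻¹ ∈ H := by
      by_contra! h
      exact hg ((hmem g).2 (Or.inr h))
    let f : N → N := fun m => ⟨g⁻¹ * m * g * (m : G)⁻¹, by
      have := hnormal.conj_mem m m.2 g⁻¹
      rw [inv_inv] at this
      exact N.mul_mem this (N.inv_mem m.2)⟩
    have hf : Function.Injective f := by
      intro a b hab
      have h1 : g⁻¹ * a * g * (a : G)⁻¹ = g⁻¹ * b * g * (b : G)⁻¹ := congrArg Subtype.val hab
      have h2 : (a : G) * g * (a : G)⁻¹ = b * g * (b : G)⁻¹ := by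
        simpa [mul_assoc] using h1
      have h3 : ((b⁻¹ * a : N) : G) * g = g * ((b⁻¹ * a : N) : G) := by
        push_cast
        have : (b : G)⁻¹ * a * g = (b : G)⁻¹ * (a * g * (a : G)⁻¹) * a := by group
        rw [this, h2]; group
      have h4 : k * ((b⁻¹ * a : N) : G) * k⁻¹ ∈ H := by
        refine hfix _ hk (fun h => hg1 (by simpa using h)) _ ?_
        have : k * ((b⁻¹ * a : N) : G) * k⁻¹ * (k * g * k⁻¹) * (k * ((b⁻¹ * a : N) : G) * k⁻¹)⁻¹ =
          k * (((b⁻¹ * a : N) : G) * g) * ((b⁻¹ * a : N) : G)⁻¹ * k⁻¹ := by group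
        rw [this, h3]; group
      have h5 : b⁻¹ * a = 1 := Subtype.ext (hNH _ (b⁻¹ * a : N).2 k h4)
      exact (inv_mul_eq_one.1 h5).symm
    obtain ⟨m, hm⟩ := (Finite.injective_iff_surjective.1 hf) ⟨n, hn⟩
    have h1 : g⁻¹ * m * g * (m : G)⁻¹ = n := congrArg Subtype.val hm
    exact isConj_iff.2 ⟨m, by rw [← h1]; group⟩

theorem IsDoublyTransitiveFrobenius.exists_isCaminaSubgroup (h : IsDoublyTransitiveFrobenius G)
    {n : ℕ} (hp : (2 ^ n - 1).Prime) (hG : Nat.card G = (2 ^ n - 1) * 2 ^ n) :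
    ∃ N : Subgroup G, IsCaminaSubgroup N ∧ Nat.card N = 2 ^ n := by
  obtain ⟨H, hH, hc⟩ := h
  have := Fact.mk Nat.prime_two
  obtain ⟨r, hr⟩ : ∃ r, 2 ^ n = r + 1 := ⟨2 ^ n - 1, by have := Nat.one_le_two_pow (n := n); omega⟩
  have hr' : 2 ^ n - 1 = r := by omega
  rw [hr'] at hp hG
  have hker := hH.card_frobeniusKernel
  rw [← hc, hG, hr] at hker
  have hHr : Nat.card H = r := by
    rcases lt_trichotomy (Nat.card H) r with h | h | h
    · nlinarith
    · exact h
    · nlinarith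
  rw [hHr] at hc
  have hn : n ≠ 0 := by
    rintro rfl
    have : r = 0 := by simpa using hr.symm
    exact hp.ne_zero this
  have hcop : ¬ 2 ∣ r := by
    have : 2 ∣ r + 1 := hr ▸ dvd_pow_self 2 hn
    omega
  let P : Sylow 2 G := default
  have hP : Nat.card P = 2 ^ n := by
    rw [P.card_eq_multiplicity, hG, hr, ← hr, Nat.factorization_mul hp.ne_zero (by positivity)]
    simp [Nat.factorization_eq_zero_of_not_dvd hcop, Nat.prime_two.factorization_self]
  have hsub : ((P : Subgroup G) : Set G) ⊆ frobeniusKernel H := by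
    intro x hx
    by_cases hx1 : x = 1
    · exact Or.inl hx1
    · refine Or.inr fun g hg => hx1 ?_
      have h1 := H.orderOf_dvd_natCard hg
      have h2 := (P : Subgroup G).orderOf_dvd_natCard hx
      have h3 : orderOf (g * x * g⁻¹) = orderOf x :=
        (MulAut.conj g).orderOf_eq x
      rw [h3, hHr] at h1
      have hP' : Nat.card (P : Subgroup G) = r + 1 := hP.trans hr
      rw [hP', Nat.dvd_add_right h1] at h2
      exact orderOf_eq_one_iff.1 (Nat.dvd_one.1 h2)
  have heq : frobeniusKernel H = ((P : Subgroup G) : Set G) := by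
    refine (Set.eq_of_subset_of_ncard_le hsub ?_ (Set.toFinite _)).symm
    rw [← Nat.card_coe_set_eq, ← Nat.card_coe_set_eq, ← hc, ← hr, ← hP]
    rfl
  exact ⟨P, hH.isCaminaSubgroup heq (by rw [hHr, ← hr]; exact hP.symm), hP⟩

end Frobenius

end CD1

theorem corollary5p1 {G : Type*} [Group G] [Finite G] (r : ℕ) (hr : r.Prime) :
    (CD1.IsCD1Group G ∧ IsGreatest (CD1.irrDegrees G) r) ↔
      ((r = 2 ∧ (Nonempty (G ≃* Equiv.Perm (Fin 3)) ∨ Nonempty (G ≃* DihedralGroup 4) ∨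
          Nonempty (G ≃* QuaternionGroup 2))) ∨
        (∃ n : ℕ, r = 2 ^ n - 1 ∧ CD1.IsDoublyTransitiveFrobenius G ∧
          Nat.card G = (2 ^ n - 1) * 2 ^ n)) := by
  constructor
  · rw [CD1.isCD1Group_and_isGreatest_iff]
    rintro ⟨hG, N, hN, h⟩
    rcases hN.index_eq_of_prime hG hr h with ⟨h2, hi⟩ | ⟨hc, hi⟩
    · obtain ⟨h1, h3⟩ := hN.eq_two_of_card_eq_two hr h2 hi
      exact Or.inl ⟨h1, Or.inr h3⟩
    · rcases hr.eq_two_or_odd with rfl | hodd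
      · exact Or.inl ⟨rfl, Or.inl (hN.equiv_perm hc hi)⟩
      · right
        obtain ⟨n, hn⟩ := hN.exists_card_eq_two_pow (by omega)
        have hrn : r = 2 ^ n - 1 := by omega
        refine ⟨n, hrn, hN.isDoublyTransitiveFrobenius hr hc hi, ?_⟩
        rw [← N.card_mul_index, hi, hn, ← hrn, mul_comm]
  · rintro (⟨rfl, ⟨⟨e⟩⟩ | ⟨⟨e⟩⟩ | ⟨⟨e⟩⟩⟩ | ⟨n, rfl, hF, hG⟩)
    · have h1 : Nat.card (Equiv.Perm (Fin 3)) = 6 := by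
        rw [Nat.card_perm, Nat.card_fin]; rfl
      have h2 : Nat.card (alternatingGroup (Fin 3)) = 3 := by
        have := two_mul_nat_card_alternatingGroup (α := Fin 3)
        omega
      exact CD1.isCD1Group_of_mulEquiv e CD1.isCaminaSubgroup_alternatingGroup (by omega)
        (by rw [h1, h2]; rfl)
    · have h1 : Nat.card (DihedralGroup 4) = 8 := DihedralGroup.nat_card
      have h2 : Nat.card (Subgroup.zpowers (DihedralGroup.r 2 : DihedralGroup 4)) = 2 := by
        rw [Nat.card_zpowers]; exact orderOf_eq_prime (by decide) (by decide)
      exact CD1.isCD1Group_of_mulEquiv e CD1.isCaminaSubgroup_dihedralGroup (by omega)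
        (by rw [h1, h2]; rfl)
    · have h1 : Nat.card (QuaternionGroup 2) = 8 := by
        rw [Nat.card_eq_fintype_card, QuaternionGroup.card]
      have h2 : Nat.card (Subgroup.zpowers (QuaternionGroup.a 2 : QuaternionGroup 2)) = 2 := by
        rw [Nat.card_zpowers]; exact orderOf_eq_prime (by decide) (by decide)
      exact CD1.isCD1Group_of_mulEquiv e CD1.isCaminaSubgroup_quaternionGroup (by omega)
        (by rw [h1, h2]; rfl)
    · obtain ⟨N, hN, hc⟩ := hF.exists_isCaminaSubgroup hr hG
      have h1 := hr.two_le
      refine hN.isCD1Group ?_ ?_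
      · rw [hG]; nlinarith [Nat.sub_le (2 ^ n) 1]
      · rw [hG, hc]
        obtain ⟨r, hr⟩ : ∃ r, 2 ^ n = r + 1 := ⟨2 ^ n - 1, by omega⟩
        rw [hr, Nat.add_sub_cancel]
        ring
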